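/- Let $G$ be a finite group and let $k$ be a field of characteristic $0$ over which every ordinary representation of $G$ is defined, i.e. for an algebraic closure $\bar k$ of $k$, every homomorphism $G\to GL_n(\bar k)$ is conjugate to one with values in $GL_n(k)$. Let $\widehat G$ be the set of isomorphism classes of irreducible representations of $G$ over $k$, so that $kG=\bigoplus_{V\in\widehat G}\mathfrak{gl}(V)$. Let $\alpha:G\to k^\times$ be a multiplicative character and let $\tau$ be an automorphism of $G$ with $\tau^2=1$ and $\alpha\circ\tau=\alpha$, so that $S:g\mapsto\alpha(g)\tau(g^{-1})$ extends to an involutive antiautomorphism of $kG$. Let $\mathcal L_{\alpha,\tau}(G)\subset kG$ be the linear span of the elements $g-\alpha(g)\tau(g^{-1})$, $g\in G$; it is a Lie subalgebra of $kG$ for the bracket $[a,b]=ab-ba$. For $V\in\widehat G$ put $V'=(V^*\otimes\alpha)\circ\tau$; on characters this is $\chi\mapsto\alpha\cdot\overline{\chi}\circ\tau$, where $\overline\chi(g)=\chi(g^{-1})$. Consider on $\widehat G$ the equivalence relation generated by $V\sim V'$; its classes are the sets $\{V,V'\}$. * If $V\simeq V'$, there is a nondegenerate bilinear form $\phi$ on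 $V$, unique up to a scalar, with $\phi(g x,\tau(g)y)=\alpha(g)\phi(x,y)$ for all $g\in G$ and $x,y\in V$. Let $\mathfrak{osp}_{\alpha,\tau}(V)=\{X\in\mathfrak{gl}(V) : \phi(Xx,y)+\phi(x,Xy)=0\ \text{for all } x,y\in V\}$, regarded inside the summand $\mathfrak{gl}(V)$ of $kG$. * If $V\not\simeq V'$, let $\mathfrak{gl}_{\alpha,\tau}(V)=\{(X,-{}^tX) : X\in\mathfrak{gl}(V)\}$, regarded inside the summand $\mathfrak{gl}(V)\oplus\mathfrak{gl}(V')$ of $kG$. Each of these Lie subalgebras of $kG$ depends only on the class of $V$. Let $\mathcal M_{\alpha,\tau}(G)\subset kG$ be the sum of the $\mathfrak{osp}_{\alpha,\tau}(V)$ over the classes with one element and of the $\mathfrak{gl}_{\alpha,\tau}(V)$ over the classes with two elements. Then this sum is direct, and $\mathcal L_{\alpha,\tau}(G)=\mathcal M_{\alpha,\tau}(G)$. -/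

import Mathlib

attribute [local instance] LieRing.ofAssociativeRing

namespace TwistedGroupLie

open Module

universe u v

/-- Every linear representation of `G` over an algebraic closure of `k` is defined over `k`:
each homomorphism `G → GL_n(k̄)` is conjugate to one with values in `GL_n(k)`. -/
def RepsDefinedOver (k : Type u) [Field k] (G : Type v) [Group G] : Prop :=
  ∀ (n : ℕ) (R : G →* GL (Fin n) (AlgebraicClosure k)),
    ∃ (R₀ : G →* GL (Fin n) k) (P : GL (Fin n) (AlgebraicClosure k)), ∀ g : G,
      R g = P * Matrix.GeneralLinearGroup.map (algebraMap k (AlgebraicClosure k)) (R₀ g) * P⁻¹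

section

variable {k : Type u} [Field k] {G : Type v} [Group G]

/-! ### The Lie algebra `L_{α,τ}(G)` -/

/-- The element `g - α(g) τ(g⁻¹)` of the group algebra. -/
noncomputable def antiElt (α : G →* kˣ) (τ : G ≃* G) (g : G) : MonoidAlgebra k G :=
  MonoidAlgebra.of k G g - (α g : k) • MonoidAlgebra.of k G (τ g⁻¹)

theorem lie_antiElt (α : G →* kˣ) (τ : G ≃* G) (hτ : ∀ g, τ (τ g) = g)
    (hα : ∀ g, α (τ g) = α g) (g h : G) :
    ⁅antiElt α τ g, antiElt α τ h⁆ =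
      antiElt α τ (g * h) - antiElt α τ (h * g)
        - (α h : k) • antiElt α τ (g * τ h⁻¹) + (α h : k) • antiElt α τ (τ h⁻¹ * g) := by
  have hh : (α h : k) ≠ 0 := (α h).ne_zero
  rw [LieRing.of_associative_ring_bracket]
  simp only [antiElt, MonoidAlgebra.of_apply, map_mul, mul_inv_rev, map_inv, inv_inv, hτ, hα,
    Units.val_mul, Units.val_inv_eq_inv_val, smul_sub, sub_mul, mul_sub,
    MonoidAlgebra.single_mul_single, MonoidAlgebra.smul_single, smul_eq_mul, mul_one, one_mul]
  have e1 : (α h : k) * ((α g : k) * (α h : k)⁻¹) = α g := by field_simp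
  have e2 : (α h : k) * ((α h : k)⁻¹ * (α g : k)) = α g := by field_simp
  rw [e1, e2, mul_comm (α h : k) (α g : k)]
  abel

/-- `L_{α,τ}(G)`: the linear span of the elements `g - α(g) τ(g⁻¹)`, a Lie subalgebra of `k[G]`
for the commutator bracket. -/
noncomputable def lieL (α : G →* kˣ) (τ : G ≃* G) (hτ : ∀ g, τ (τ g) = g)
    (hα : ∀ g, α (τ g) = α g) : LieSubalgebra k (MonoidAlgebra k G) where
  __ := Submodule.span k (Set.range (antiElt α τ))
  lie_mem' := by
    intro x y hx hy
    change x ∈ Submodule.span k (Set.range (antiElt α τ)) at hx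
    change y ∈ Submodule.span k (Set.range (antiElt α τ)) at hy
    change ⁅x, y⁆ ∈ Submodule.span k (Set.range (antiElt α τ))
    have hm (g : G) : antiElt α τ g ∈ Submodule.span k (Set.range (antiElt α τ)) :=
      Submodule.subset_span ⟨g, rfl⟩
    induction hx, hy using Submodule.span_induction₂ with
    | mem_mem x y hx hy =>
      obtain ⟨g, rfl⟩ := hx
      obtain ⟨h, rfl⟩ := hy
      rw [lie_antiElt α τ hτ hα]
      exact add_mem (sub_mem (sub_mem (hm _) (hm _)) (Submodule.smul_mem _ _ (hm _)))
        (Submodule.smul_mem _ _ (hm _))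
    | zero_left y hy => simp
    | zero_right x hx => simp
    | add_left x y z _ _ _ h₁ h₂ => rw [add_lie]; exact add_mem h₁ h₂
    | add_right x y z _ _ _ h₁ h₂ => rw [lie_add]; exact add_mem h₁ h₂
    | smul_left r x y _ _ h => rw [smul_lie]; exact Submodule.smul_mem _ _ h
    | smul_right r x y _ _ h => rw [lie_smul]; exact Submodule.smul_mem _ _ h

/-! ### Irreducible representations and the involution `V ↦ (V* ⊗ α) ∘ τ` -/

/-- Isomorphism of representations. -/
def Iso {V : Type*} [AddCommGroup V] [Module k V] {W : Type*} [AddCommGroup W] [Module k W]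
    (ρ : Representation k G V) (σ : Representation k G W) : Prop :=
  Nonempty (ρ.Equiv σ)

variable (k G) in
/-- The irreducible representations of `G` over `k` on the spaces `k^n`. For a finite group `G`,
every irreducible representation is isomorphic to one of these. -/
structure Irr where
  /-- the dimension -/
  dim : ℕ
  /-- the representation -/
  rep : Representation k G (Fin dim → k)
  irreducible : rep.IsIrreducible

/-- The representation `(V* ⊗ α) ∘ τ` on the dual space of `V`; its character is
`g ↦ α(τ(g)) χ_V(τ(g)⁻¹)`. -/
noncomputable def twistDual (α : G →* kˣ) (τ : G ≃* G) {V : Type*} [AddCommGroup V] [Module k V]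
    (ρ : Representation k G V) : Representation k G (Dual k V) where
  toFun g := (α (τ g) : k) • ρ.dual (τ g)
  map_one' := by rw [map_one, map_one, map_one, Units.val_one, one_smul]
  map_mul' g h := by
    rw [map_mul, map_mul, map_mul, Units.val_mul, smul_mul_smul_comm]

/-! ### The Lie algebras `osp_{α,τ}(V)` and `gl_{α,τ}(V)` inside `k[G] = ⨁ gl(V)` -/

/-- The elements of `k[G]` whose component on `gl(W)` is zero for every irreducible `W`
not satisfying `p`, that is, the subspace `⨁_{W with p} gl(W)` of `k[G] = ⨁_W gl(W)`. -/
noncomputable def blocks (p : Irr k G → Prop) : LieSubalgebra k (MonoidAlgebra k G) where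
  carrier := {x | ∀ W : Irr k G, ¬ p W → W.rep.asAlgebraHom x = 0}
  zero_mem' := fun W _ => map_zero _
  add_mem' := fun hx hy W hW => by rw [map_add, hx W hW, hy W hW, add_zero]
  smul_mem' := fun r x hx W hW => by rw [map_smul, hx W hW, smul_zero]
  lie_mem' := fun {x y} hx hy W hW => by
    rw [LieRing.of_associative_ring_bracket, map_sub, map_mul, map_mul, hx W hW, hy W hW]
    simp

/-- The nondegenerate bilinear forms `φ` on `V` with `φ(g x, τ(g) y) = α(g) φ(x, y)`. -/
def IsTwistedForm (α : G →* kˣ) (τ : G ≃* G) {V : Type*} [AddCommGroup V] [Module k V]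
    (ρ : Representation k G V) (φ : LinearMap.BilinForm k V) : Prop :=
  φ.Nondegenerate ∧ ∀ (g : G) (x y : V), φ (ρ g x) (ρ (τ g) y) = (α g : k) * φ x y

/-- The Lie subalgebra of `gl(V)` of the endomorphisms `X` with `φ(X x, y) + φ(x, X y) = 0` for the
nondegenerate form `φ` with `φ(g x, τ(g) y) = α(g) φ(x, y)`. Such a form is unique up to a
scalar when `V` is absolutely irreducible, so the forms quantified over are the scalar multiples of one form. -/
noncomputable def ospEnd (α : G →* kˣ) (τ : G ≃* G) {V : Type*} [AddCommGroup V] [Module k V]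
    (ρ : Representation k G V) : LieSubalgebra k (Module.End k V) where
  carrier := {X | ∀ φ : LinearMap.BilinForm k V, IsTwistedForm α τ ρ φ →
    X ∈ skewAdjointLieSubalgebra φ}
  zero_mem' := fun _ _ => zero_mem _
  add_mem' := fun hX hY φ hφ => add_mem (hX φ hφ) (hY φ hφ)
  smul_mem' := fun r _ hX φ hφ => (skewAdjointLieSubalgebra φ).smul_mem r (hX φ hφ)
  lie_mem' := fun hX hY φ hφ => (skewAdjointLieSubalgebra φ).lie_mem (hX φ hφ) (hY φ hφ)

/-- `osp_{α,τ}(V)` inside the summand `gl(V)` of `k[G]`. -/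
noncomputable def osp (α : G →* kˣ) (τ : G ≃* G) {V : Type*} [AddCommGroup V] [Module k V]
    (ρ : Representation k G V) : LieSubalgebra k (MonoidAlgebra k G) :=
  blocks (fun W => Iso W.rep ρ) ⊓
    (ospEnd α τ ρ).comap (ρ.asAlgebraHom : MonoidAlgebra k G →ₗ⁅k⁆ Module.End k V)

/-- `gl_{α,τ}(V)` inside the summand `gl(V) ⊕ gl(V')` of `k[G]`, where `V' = (V* ⊗ α) ∘ τ`:
the elements whose components on `gl(V)` and `gl(V')` have the form `(X, -ᵗX)`. -/
noncomputable def gl (α : G →* kˣ) (τ : G ≃* G) {V : Type*} [AddCommGroup V] [Module k V]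
    (ρ : Representation k G V) : LieSubalgebra k (MonoidAlgebra k G) :=
  blocks (fun W => Iso W.rep ρ ∨ Iso W.rep (twistDual α τ ρ)) ⊓
    { carrier := {x | (twistDual α τ ρ).asAlgebraHom x = -(ρ.asAlgebraHom x).dualMap}
      zero_mem' := by
        ext
        simp
      add_mem' := fun {x y} hx hy => by
        simp only [Set.mem_ofPred_eq] at hx hy ⊢
        rw [map_add, hx, hy, map_add]
        ext
        simp [add_comm]
      smul_mem' := fun r x hx => by
        simp only [Set.mem_ofPred_eq] at hx ⊢
        rw [map_smul, hx, map_smul]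
        ext
        simp
      lie_mem' := fun {x y} hx hy => by
        change (twistDual α τ ρ).asAlgebraHom x = -(ρ.asAlgebraHom x).dualMap at hx
        change (twistDual α τ ρ).asAlgebraHom y = -(ρ.asAlgebraHom y).dualMap at hy
        change (twistDual α τ ρ).asAlgebraHom ⁅x, y⁆ = -(ρ.asAlgebraHom ⁅x, y⁆).dualMap
        simp only [LieRing.of_associative_ring_bracket, map_sub, map_mul, hx, hy]
        ext f v
        simp }

/-! ### The Lie algebra `M_{α,τ}(G)` -/

/-- The set of classes of irreducible representations for the equivalence relation generated by
isomorphism and `V ∼ (V* ⊗ α) ∘ τ`. -/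
def IrrClass (α : G →* kˣ) (τ : G ≃* G) : Type (max u v) :=
  Quot fun V W : Irr k G => Iso V.rep W.rep ∨ Iso V.rep (twistDual α τ W.rep)

open Classical in
/-- The Lie subalgebra of `k[G]` attached to the class of `V`: it is `osp_{α,τ}(V)` if
`V ≃ (V* ⊗ α) ∘ τ`, and `gl_{α,τ}(V)` otherwise. -/
noncomputable def component (α : G →* kˣ) (τ : G ≃* G) (V : Irr k G) :
    LieSubalgebra k (MonoidAlgebra k G) :=
  if Iso V.rep (twistDual α τ V.rep) then osp α τ V.rep else gl α τ V.rep

/-- The summand of `M_{α,τ}(G)` attached to a class: the common value of `component α τ V` for all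
`V` in the class. -/
noncomputable def summand (α : G →* kˣ) (τ : G ≃* G) (c : IrrClass α τ) :
    Submodule k (MonoidAlgebra k G) :=
  ⨆ (V : Irr k G) (_ : Quot.mk _ V = c), (component α τ V).toSubmodule

/-- `M_{α,τ}(G)`: the sum of the `osp_{α,τ}(V)` and the `gl_{α,τ}(V)` over all classes. -/
noncomputable def lieM (α : G →* kˣ) (τ : G ≃* G) : Submodule k (MonoidAlgebra k G) :=
  ⨆ c : IrrClass α τ, summand α τ c

end

end TwistedGroupLie

namespace TwistedGroupLie

open Module

variable {k : Type*} [Field k] {G : Type*} [Group G]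
  {V : Type*} [AddCommGroup V] [Module k V] {W : Type*} [AddCommGroup W] [Module k W]
  {U : Type*} [AddCommGroup U] [Module k U]

/-! ### Irreducible representations -/

/-! Let S be the antiautomorphism g ↦ α(g) τ(g⁻¹) of kG (`anti`). It is an involution and 2 is
invertible, so L is the (-1)-eigenspace of S (`mem_lieL_iff`). The action of x on V' is the
transpose of the action of S x on V (`twistDual_asAlgebraHom`), so S exchanges the blocks of V and
V'.

For a twisted form φ the adjoint of ρ(x) is ρ(S x). Hence the `osp` condition and the `gl` condition
both say that S x + x acts as zero on V. The summand of a class is therefore L intersected with the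
blocks of that class (`mem_component_iff_mem_lieL`).

By Maschke, kG is a sum of simple left ideals, each inside one block. If x lies in the block of V,
then x - S x lies in the component of V; by linearity L ⊆ M, and the converse is immediate. The sum
is direct because distinct classes occupy disjoint sets of blocks and an element killed by every
irreducible representation is zero. -/

theorem isIrreducible_iff (ρ : Representation k G V) :
    ρ.IsIrreducible ↔ Nontrivial V ∧
      ∀ U : Submodule k V, (∀ g, ∀ v ∈ U, ρ g v ∈ U) → U = ⊥ ∨ U = ⊤ := by
  constructor
  · intro h
    refine ⟨?_, fun U hU => ?_⟩
    · by_contra hV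
      rw [not_nontrivial_iff_subsingleton] at hV
      exact bot_ne_top (α := Subrepresentation ρ)
        (Subrepresentation.toSubmodule_injective (Subsingleton.elim _ _))
    · rcases h.eq_bot_or_eq_top ⟨U, fun g v hv => hU g v hv⟩ with h | h
      · exact Or.inl (congrArg Subrepresentation.toSubmodule h)
      · exact Or.inr (congrArg Subrepresentation.toSubmodule h)
  · rintro ⟨hV, h⟩
    have : Nontrivial (Subrepresentation ρ) :=
      ⟨⊥, ⊤, fun e => bot_ne_top (congrArg Subrepresentation.toSubmodule e :
        (⊥ : Submodule k V) = ⊤)⟩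
    exact ⟨fun U => (h U.toSubmodule fun g v hv => U.apply_mem_toSubmodule g hv).imp
      (fun e => Subrepresentation.toSubmodule_injective e)
      (fun e => Subrepresentation.toSubmodule_injective e)⟩

theorem Iso.symm {ρ : Representation k G V} {σ : Representation k G W} (h : Iso ρ σ) : Iso σ ρ :=
  h.map Representation.Equiv.symm

theorem Iso.trans {ρ : Representation k G V} {σ : Representation k G W}
    {π : Representation k G U} (h : Iso ρ σ) (h' : Iso σ π) : Iso ρ π :=
  ⟨h.some.trans h'.some⟩

theorem iso_or_eq_zero {ρ : Representation k G V} {σ : Representation k G W}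
    [ρ.IsIrreducible] [σ.IsIrreducible] (f : ρ.IntertwiningMap σ) : Iso ρ σ ∨ f = 0 :=
  (Representation.IsIrreducible.bijective_or_eq_zero f).imp_left fun h => ⟨f.ofBijective h⟩

theorem intertwiningMap_asAlgebraHom {ρ : Representation k G V} {σ : Representation k G W}
    (f : ρ.IntertwiningMap σ) (x : MonoidAlgebra k G) (v : V) :
    f (ρ.asAlgebraHom x v) = σ.asAlgebraHom x (f v) := by
  induction x using MonoidAlgebra.induction_linear with
  | zero => simp
  | add x y hx hy => simp [hx, hy]
  | single g a => simp [f.isIntertwining]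

theorem Iso.asAlgebraHom_eq_zero {ρ : Representation k G V} {σ : Representation k G W}
    (h : Iso ρ σ) {x : MonoidAlgebra k G} (hx : σ.asAlgebraHom x = 0) :
    ρ.asAlgebraHom x = 0 := by
  obtain ⟨e⟩ := h
  ext v
  apply e.toLinearEquiv.injective
  have := intertwiningMap_asAlgebraHom e.toIntertwiningMap x v
  rw [hx] at this
  simpa using this

theorem isIrreducible_of_iso {ρ : Representation k G V} {σ : Representation k G W}
    (h : Iso ρ σ) (hσ : σ.IsIrreducible) : ρ.IsIrreducible := by
  obtain ⟨e⟩ := h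
  rw [isIrreducible_iff] at hσ ⊢
  obtain ⟨_, hσ⟩ := hσ
  refine ⟨e.toLinearEquiv.toEquiv.nontrivial, fun U hU => ?_⟩
  have := hσ (U.map e.toLinearEquiv.toLinearMap) (by
    rintro g _ ⟨v, hv, rfl⟩
    exact ⟨ρ g v, hU g v hv, e.toIntertwiningMap.isIntertwining _ _ g v⟩)
  exact this.imp (fun h => (Submodule.map_eq_bot_iff (e := e.toLinearEquiv)).1 h)
    fun h => Submodule.map_injective_of_injective e.toLinearEquiv.injective
      (h.trans (by rw [Submodule.map_top]; exact e.toLinearEquiv.range.symm))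

theorem exists_irr_iso [FiniteDimensional k V] (ρ : Representation k G V) (h : ρ.IsIrreducible) :
    ∃ W : Irr k G, Iso W.rep ρ := by
  let e : V ≃ₗ[k] (Fin (finrank k V) → k) := (finBasis k V).equivFun
  let σ : Representation k G (Fin (finrank k V) → k) :=
    { toFun g := e.conj (ρ g)
      map_one' := by ext; simp
      map_mul' g h := by
        ext
        simp }
  have hσ : Iso σ ρ := ⟨(Representation.Equiv.mk e fun g => by ext; simp [σ]).symm⟩
  exact ⟨⟨_, σ, isIrreducible_of_iso hσ h⟩, hσ⟩

/-! ### The block decomposition of the group algebra -/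

section Blocks

/-- The representation of `G` on a left ideal of its group algebra. -/
noncomputable def idealRep (N : Submodule (MonoidAlgebra k G) (MonoidAlgebra k G)) :
    Representation k G N :=
  ((Algebra.lsmul k k N : MonoidAlgebra k G →ₐ[k] End k N) :
    MonoidAlgebra k G →* End k N).comp (MonoidAlgebra.of k G)

theorem idealRep_apply (N : Submodule (MonoidAlgebra k G) (MonoidAlgebra k G)) (g : G) (n : N) :
    idealRep N g n = MonoidAlgebra.of k G g • n := rfl

theorem idealRep_asAlgebraHom (N : Submodule (MonoidAlgebra k G) (MonoidAlgebra k G)) :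
    (idealRep N).asAlgebraHom = Algebra.lsmul k k N :=
  (MonoidAlgebra.lift k (End k N) G).apply_symm_apply (Algebra.lsmul k k N)

theorem isIrreducible_idealRep (N : Submodule (MonoidAlgebra k G) (MonoidAlgebra k G))
    [hN : IsSimpleModule (MonoidAlgebra k G) N] : (idealRep N).IsIrreducible := by
  rw [isIrreducible_iff]
  refine ⟨IsSimpleModule.nontrivial (MonoidAlgebra k G) N, fun U hU => ?_⟩
  let U' : Submodule (MonoidAlgebra k G) N :=
    { U with
      smul_mem' := fun x n hn => by
        induction x using MonoidAlgebra.induction_linear with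
        | zero => rw [zero_smul]; exact U.zero_mem
        | add x y hx hy => rw [add_smul]; exact U.add_mem hx hy
        | single g a =>
          have : MonoidAlgebra.single g a = a • MonoidAlgebra.of k G g := by simp
          rw [this, smul_assoc]
          exact U.smul_mem a (hU g n hn) }
  refine (eq_bot_or_eq_top U').imp (fun h => ?_) fun h => ?_
  · ext n; exact SetLike.ext_iff.1 h n
  · ext n; exact SetLike.ext_iff.1 h n

/-- For fixed w in W, the map n ↦ n w is an intertwiner N → W, so Schur's lemma makes it zero unless
W ≃ N. -/
theorem le_blocks_idealRep (N : Submodule (MonoidAlgebra k G) (MonoidAlgebra k G))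
    [hN : IsSimpleModule (MonoidAlgebra k G) N] {x : MonoidAlgebra k G} (hx : x ∈ N) :
    x ∈ blocks (fun W => Iso W.rep (idealRep N)) := by
  intro W hW
  have := W.irreducible
  have := isIrreducible_idealRep N
  refine LinearMap.ext fun w => ?_
  let f : (idealRep N).IntertwiningMap W.rep :=
    { toLinearMap := LinearMap.applyₗ w ∘ₗ W.rep.asAlgebraHom.toLinearMap ∘ₗ
        N.subtype.restrictScalars k
      isIntertwining' g := by
        refine LinearMap.ext fun n => ?_
        change W.rep.asAlgebraHom ((idealRep N g n : N) : MonoidAlgebra k G) w =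
          W.rep g (W.rep.asAlgebraHom (n : MonoidAlgebra k G) w)
        rw [idealRep_apply, Submodule.coe_smul, smul_eq_mul, map_mul,
          Representation.asAlgebraHom_of]
        rfl }
  rcases iso_or_eq_zero f with h | h
  · exact (hW h.symm).elim
  · have h0 := congrArg Representation.IntertwiningMap.toLinearMap h
    exact LinearMap.congr_fun h0 (⟨x, hx⟩ : N)

variable [CharZero k] [Finite G]

/-- Maschke's theorem writes kG as a sum of simple left ideals, each contained in a single block.
This is the spanning half of the block decomposition. -/
theorem blocks_induction {P : MonoidAlgebra k G → Prop} (h0 : P 0)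
    (hadd : ∀ x y, P x → P y → P (x + y))
    (h : ∀ (V : Irr k G) (x : MonoidAlgebra k G),
      x ∈ blocks (fun W => Iso W.rep V.rep) → P x) (x : MonoidAlgebra k G) : P x := by
  have : NeZero (Nat.card G : k) := ⟨by exact_mod_cast Nat.card_pos.ne'⟩
  have htop := IsSemisimpleModule.sSup_simples_eq_top (MonoidAlgebra k G) (MonoidAlgebra k G)
  have hx : x ∈ sSup {N : Submodule (MonoidAlgebra k G) (MonoidAlgebra k G) |
      IsSimpleModule (MonoidAlgebra k G) N} := htop ▸ Submodule.mem_top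
  rw [sSup_eq_iSup'] at hx
  induction hx using Submodule.iSup_induction' with
  | mem N x hx =>
    have : IsSimpleModule (MonoidAlgebra k G) N.1 := N.2
    have : FiniteDimensional k N.1 :=
      FiniteDimensional.finiteDimensional_submodule (N.1.restrictScalars k)
    obtain ⟨V, hV⟩ := exists_irr_iso _ (isIrreducible_idealRep N.1)
    exact h V x fun W hW => le_blocks_idealRep N.1 hx W fun h' => hW (h'.trans hV.symm)
  | zero => exact h0
  | add x y _ _ hx hy => exact hadd x y hx hy

/-- Such an x annihilates every simple left ideal, hence their sum kG, and in particular x * 1 = 0.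
-/
theorem eq_zero_of_forall_irr {x : MonoidAlgebra k G}
    (hx : ∀ W : Irr k G, W.rep.asAlgebraHom x = 0) : x = 0 := by
  have : NeZero (Nat.card G : k) := ⟨by exact_mod_cast Nat.card_pos.ne'⟩
  have htop := IsSemisimpleModule.sSup_simples_eq_top (MonoidAlgebra k G) (MonoidAlgebra k G)
  have key (y : MonoidAlgebra k G) : x * y = 0 := by
    have hy : y ∈ sSup {N : Submodule (MonoidAlgebra k G) (MonoidAlgebra k G) |
        IsSimpleModule (MonoidAlgebra k G) N} := htop ▸ Submodule.mem_top
    rw [sSup_eq_iSup'] at hy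
    induction hy using Submodule.iSup_induction' with
    | mem N y hy =>
      have : IsSimpleModule (MonoidAlgebra k G) N.1 := N.2
      have : FiniteDimensional k N.1 :=
        FiniteDimensional.finiteDimensional_submodule (N.1.restrictScalars k)
      obtain ⟨V, hV⟩ := exists_irr_iso _ (isIrreducible_idealRep N.1)
      have h0 := hV.symm.asAlgebraHom_eq_zero (hx V)
      rw [idealRep_asAlgebraHom] at h0
      exact congrArg Subtype.val (DFunLike.congr_fun h0 (⟨y, hy⟩ : N.1))
    | zero => exact mul_zero x
    | add y z _ _ hy hz => rw [mul_add, hy, hz, add_zero]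
  simpa using key 1

end Blocks

/-! ### The antiautomorphism `g ↦ α(g) τ(g⁻¹)` -/

section Anti

/-- The antiautomorphism of `k[G]` extending `g ↦ α(g) τ(g⁻¹)`. -/
noncomputable def antiAut (α : G →* kˣ) (τ : G ≃* G) :
    MonoidAlgebra k G →ₐ[k] (MonoidAlgebra k G)ᵐᵒᵖ :=
  MonoidAlgebra.lift k _ G
    { toFun g := MulOpposite.op ((α g : k) • MonoidAlgebra.of k G (τ g⁻¹))
      map_one' := by simp [MonoidAlgebra.one_def]
      map_mul' g h := by
        rw [← MulOpposite.op_mul, smul_mul_smul_comm, ← map_mul, ← map_mul, ← mul_inv_rev, map_mul,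
          Units.val_mul, mul_comm (α g : k)] }

/-- The linear map underlying `antiAut`. -/
noncomputable def anti (α : G →* kˣ) (τ : G ≃* G) : MonoidAlgebra k G →ₗ[k] MonoidAlgebra k G :=
  (MulOpposite.opLinearEquiv k).symm.toLinearMap ∘ₗ (antiAut α τ).toLinearMap

variable (α : G →* kˣ) (τ : G ≃* G)

theorem anti_single (g : G) (a : k) :
    anti α τ (MonoidAlgebra.single g a) = (a * α g) • MonoidAlgebra.of k G (τ g⁻¹) := by
  simp [anti, antiAut]

theorem anti_anti (hτ : ∀ g, τ (τ g) = g) (hα : ∀ g, α (τ g) = α g) (x : MonoidAlgebra k G) :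
    anti α τ (anti α τ x) = x := by
  induction x using MonoidAlgebra.induction_linear with
  | zero => simp
  | add x y hx hy => rw [map_add, map_add, hx, hy]
  | single g a =>
    rw [anti_single, map_smul, MonoidAlgebra.of_apply, anti_single]
    simp [hτ, hα]

theorem sub_anti_mem_span (x : MonoidAlgebra k G) :
    x - anti α τ x ∈ Submodule.span k (Set.range (antiElt α τ)) := by
  induction x using MonoidAlgebra.induction_linear with
  | zero => simp
  | add x y hx hy => rw [map_add, add_sub_add_comm]; exact add_mem hx hy
  | single g a =>
    have : MonoidAlgebra.single g a - anti α τ (MonoidAlgebra.single g a) =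
        a • antiElt α τ g := by
      rw [anti_single, antiElt, smul_sub, mul_smul]; simp
    rw [this]
    exact Submodule.smul_mem _ _ (Submodule.subset_span ⟨g, rfl⟩)

/-- The generators are g - S g. Conversely S x = -x gives x = ½(x - S x). -/
theorem mem_lieL_iff [CharZero k] (hτ : ∀ g, τ (τ g) = g) (hα : ∀ g, α (τ g) = α g)
    (x : MonoidAlgebra k G) : x ∈ lieL α τ hτ hα ↔ anti α τ x = -x := by
  change x ∈ Submodule.span k (Set.range (antiElt α τ)) ↔ _
  constructor
  · intro hx
    induction hx using Submodule.span_induction with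
    | mem x hx =>
      obtain ⟨g, rfl⟩ := hx
      have : antiElt α τ g = MonoidAlgebra.of k G g - anti α τ (MonoidAlgebra.of k G g) := by
        rw [MonoidAlgebra.of_apply, anti_single, one_mul]; rfl
      rw [this, map_sub, anti_anti α τ hτ hα, neg_sub]
    | zero => simp
    | add x y _ _ hx hy => rw [map_add, hx, hy, neg_add]
    | smul r x _ hx => rw [map_smul, hx, smul_neg]
  · intro hx
    have h2 : x = (2⁻¹ : k) • (x - anti α τ x) := by
      rw [hx, sub_neg_eq_add, ← two_smul k x, smul_smul, inv_mul_cancel₀ two_ne_zero, one_smul]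
    rw [h2]
    exact Submodule.smul_mem _ _ (sub_anti_mem_span α τ x)

theorem twistDual_apply (hα : ∀ g, α (τ g) = α g) (ρ : Representation k G V) (g : G)
    (f : Dual k V) (v : V) : twistDual α τ ρ g f v = (α g : k) * f (ρ (τ g⁻¹) v) := by
  simp [twistDual, hα, Dual.transpose_apply]

theorem twistDual_asAlgebraHom (hα : ∀ g, α (τ g) = α g) (ρ : Representation k G V)
    (x : MonoidAlgebra k G) :
    (twistDual α τ ρ).asAlgebraHom x = (ρ.asAlgebraHom (anti α τ x)).dualMap := by
  induction x using MonoidAlgebra.induction_linear with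
  | zero => ext; simp
  | add x y hx hy => rw [map_add, map_add, map_add, hx, hy]; ext; simp
  | single g a =>
    ext f v
    rw [anti_single, map_smul, Representation.asAlgebraHom_of]
    simp [twistDual_apply α τ hα, mul_assoc]

theorem twistDual_asAlgebraHom_eq_zero (hα : ∀ g, α (τ g) = α g) (ρ : Representation k G V)
    {x : MonoidAlgebra k G} :
    (twistDual α τ ρ).asAlgebraHom x = 0 ↔ ρ.asAlgebraHom (anti α τ x) = 0 := by
  rw [twistDual_asAlgebraHom α τ hα]
  constructor
  · intro h
    ext1 v
    exact (forall_dual_apply_eq_zero_iff k _).1 fun f =>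
      LinearMap.congr_fun (LinearMap.congr_fun h f) v
  · intro h
    rw [h]
    ext; simp

theorem Iso.twistDual (hα : ∀ g, α (τ g) = α g) {ρ : Representation k G V}
    {σ : Representation k G W} (h : Iso ρ σ) : Iso (twistDual α τ σ) (twistDual α τ ρ) := by
  obtain ⟨e⟩ := h
  refine ⟨Representation.Equiv.mk e.toLinearEquiv.dualMap fun g => ?_⟩
  ext f v
  have := e.toIntertwiningMap.isIntertwining _ _ (τ g⁻¹) v
  change (TwistedGroupLie.twistDual α τ σ g f) (e v) =
    TwistedGroupLie.twistDual α τ ρ g (e.toLinearEquiv.dualMap f) v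
  rw [twistDual_apply α τ hα, twistDual_apply α τ hα]
  exact congrArg (fun w => (α g : k) * f w) this.symm

theorem iso_twistDual_twistDual [FiniteDimensional k V] (hτ : ∀ g, τ (τ g) = g)
    (hα : ∀ g, α (τ g) = α g) (ρ : Representation k G V) :
    Iso ρ (twistDual α τ (twistDual α τ ρ)) := by
  refine ⟨Representation.Equiv.mk (evalEquiv k V) fun g => ?_⟩
  ext v f
  simp [twistDual_apply α τ hα, hτ, hα]

/-- The twisted dual is contravariant and, up to isomorphism, involutive. -/
theorem iso_twistDual_comm [FiniteDimensional k V] [FiniteDimensional k W]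
    (hτ : ∀ g, τ (τ g) = g) (hα : ∀ g, α (τ g) = α g) {ρ : Representation k G V}
    {σ : Representation k G W} (h : Iso (twistDual α τ ρ) σ) : Iso ρ (twistDual α τ σ) :=
  (iso_twistDual_twistDual α τ hτ hα ρ).trans (h.symm.twistDual α τ hα)

/-- Invariant subspaces of the dual are the annihilators of invariant subspaces of V. -/
theorem isIrreducible_twistDual [FiniteDimensional k V] (hτ : ∀ g, τ (τ g) = g)
    (hα : ∀ g, α (τ g) = α g) (ρ : Representation k G V) (h : ρ.IsIrreducible) :
    (twistDual α τ ρ).IsIrreducible := by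
  rw [isIrreducible_iff] at h ⊢
  obtain ⟨_, h⟩ := h
  refine ⟨inferInstance, fun U hU => ?_⟩
  have hU' : ∀ g, ∀ v ∈ U.dualCoannihilator, ρ g v ∈ U.dualCoannihilator := by
    intro g v hv
    rw [Submodule.mem_dualCoannihilator] at hv ⊢
    intro f hf
    -- Up to a unit, τ(g⁻¹) acts on f in the twisted dual as precomposition with `ρ g`.
    have := hv _ (hU (τ g⁻¹) f hf)
    rw [twistDual_apply α τ hα] at this
    simpa [hτ] using this
  have e : U.dualCoannihilator.dualAnnihilator = U := Subspace.dualCoannihilator_dualAnnihilator_eq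
  rcases h _ hU' with h | h
  · right; rw [← e, h, Submodule.dualAnnihilator_bot]
  · left; rw [← e, h, Submodule.dualAnnihilator_top]

/-- If `x` is killed by every irreducible representation outside of `p`, then `anti α τ x` is
killed by every irreducible `W` whose twisted dual is outside of `p`. -/
theorem asAlgebraHom_anti_eq_zero (hτ : ∀ g, τ (τ g) = g) (hα : ∀ g, α (τ g) = α g)
    {p : Irr k G → Prop} {x : MonoidAlgebra k G} (hx : x ∈ blocks p) (W : Irr k G)
    (hW : ∀ V : Irr k G, p V → ¬ Iso (twistDual α τ W.rep) V.rep) :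
    W.rep.asAlgebraHom (anti α τ x) = 0 := by
  obtain ⟨V, hV⟩ := exists_irr_iso _ (isIrreducible_twistDual α τ hτ hα W.rep W.irreducible)
  rw [← twistDual_asAlgebraHom_eq_zero α τ hα]
  exact hV.symm.asAlgebraHom_eq_zero (hx V fun h => hW V h hV.symm)

end Anti

/-! ### The summands -/

section Component

variable (α : G →* kˣ) (τ : G ≃* G)

theorem IsTwistedForm.apply_asAlgebraHom {ρ : Representation k G V} {φ : LinearMap.BilinForm k V}
    (hφ : IsTwistedForm α τ ρ φ) (x : MonoidAlgebra k G) (u v : V) :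
    φ (ρ.asAlgebraHom x u) v = φ u (ρ.asAlgebraHom (anti α τ x) v) := by
  induction x using MonoidAlgebra.induction_linear with
  | zero => simp
  | add x y hx hy => simp [hx, hy]
  | single g a =>
    rw [anti_single, map_smul, Representation.asAlgebraHom_of]
    -- Invariance of φ is applied with τ(g)⁻¹ v in the second slot, which moves g across the form.
    have := hφ.2 g u (ρ (τ g⁻¹) v)
    rw [← Module.End.mul_apply, ← map_mul, ← map_mul] at this
    simp [mul_assoc] at this ⊢
    simp [this]

/-- An isomorphism V → V' is a linear map V → V*, that is, a bilinear form: bijectivity is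
nondegeneracy and intertwining is twisted invariance. -/
theorem exists_isTwistedForm [FiniteDimensional k V] (hα : ∀ g, α (τ g) = α g)
    {ρ : Representation k G V} (h : Iso ρ (twistDual α τ ρ)) : ∃ φ, IsTwistedForm α τ ρ φ := by
  obtain ⟨e⟩ := h
  refine ⟨e.toLinearEquiv.toLinearMap, ?_, fun g x y => ?_⟩
  · refine LinearMap.BilinForm.nondegenerate_iff_ker_eq_bot.2 ?_
    exact e.toLinearEquiv.ker
  · have := LinearMap.congr_fun (e.toIntertwiningMap.isIntertwining _ _ g x) (ρ (τ g) y)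
    rw [twistDual_apply α τ hα, ← Module.End.mul_apply, ← map_mul, ← map_mul] at this
    simpa using this

/-- For every twisted form the adjoint of ρ(x) is ρ(S x), so skewness does not depend on the form
chosen. Existence of one form keeps the quantifier in `ospEnd` from being vacuous. -/
theorem mem_ospEnd_iff [FiniteDimensional k V] (hα : ∀ g, α (τ g) = α g)
    {ρ : Representation k G V} (h : Iso ρ (twistDual α τ ρ)) (x : MonoidAlgebra k G) :
    ρ.asAlgebraHom x ∈ ospEnd α τ ρ ↔ ρ.asAlgebraHom (anti α τ x + x) = 0 := by
  have key (φ) (hφ : IsTwistedForm α τ ρ φ) : ρ.asAlgebraHom x ∈ skewAdjointLieSubalgebra φ ↔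
      ρ.asAlgebraHom (anti α τ x + x) = 0 := by
    change _ ∈ φ.skewAdjointSubmodule ↔ _
    rw [LinearMap.mem_skewAdjointSubmodule]
    have : φ.IsSkewAdjoint (ρ.asAlgebraHom x) ↔
        ∀ u v, φ (ρ.asAlgebraHom x u) v = - φ u (ρ.asAlgebraHom x v) := by
      simp [LinearMap.IsSkewAdjoint, LinearMap.IsAdjointPair]
    rw [this]
    constructor
    · intro h
      ext1 v
      refine hφ.1.2 _ fun u => ?_
      rw [map_add, LinearMap.add_apply, map_add, ← hφ.apply_asAlgebraHom, h, neg_add_cancel]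
    · intro h u v
      rw [hφ.apply_asAlgebraHom, ← add_eq_zero_iff_eq_neg, ← map_add, ← LinearMap.add_apply,
        ← map_add, h, LinearMap.zero_apply, map_zero]
  obtain ⟨φ, hφ⟩ := exists_isTwistedForm α τ hα h
  exact ⟨fun hx => (key φ hφ).1 (hx φ hφ), fun hx φ hφ => (key φ hφ).2 hx⟩

theorem mem_gl_iff (hα : ∀ g, α (τ g) = α g) (ρ : Representation k G V) (x : MonoidAlgebra k G) :
    x ∈ gl α τ ρ ↔ x ∈ blocks (fun W : Irr k G => Iso W.rep ρ ∨ Iso W.rep (twistDual α τ ρ)) ∧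
      ρ.asAlgebraHom (anti α τ x + x) = 0 := by
  refine and_congr_right fun _ => ?_
  change (twistDual α τ ρ).asAlgebraHom x = -(ρ.asAlgebraHom x).dualMap ↔ _
  rw [twistDual_asAlgebraHom α τ hα, map_add]
  constructor
  · intro h
    ext1 v
    refine (forall_dual_apply_eq_zero_iff k _).1 fun f => ?_
    have := LinearMap.congr_fun (LinearMap.congr_fun h f) v
    rw [LinearMap.add_apply, map_add]
    exact add_eq_zero_iff_eq_neg.2 this
  · intro h
    rw [eq_neg_of_add_eq_zero_left h]
    ext; simp

/-- A uniform description of both cases: when V ≃ V' the two alternatives in the block condition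
coincide. -/
theorem mem_component_iff (hα : ∀ g, α (τ g) = α g) (V : Irr k G) (x : MonoidAlgebra k G) :
    x ∈ component α τ V ↔
      x ∈ blocks (fun W : Irr k G => Iso W.rep V.rep ∨ Iso W.rep (twistDual α τ V.rep)) ∧
      V.rep.asAlgebraHom (anti α τ x + x) = 0 := by
  unfold component
  split_ifs with h
  · have (W : Irr k G) : Iso W.rep V.rep ∨ Iso W.rep (twistDual α τ V.rep) ↔
        Iso W.rep V.rep := or_iff_left_of_imp fun h' => h'.trans h.symm
    simp_rw [this]
    exact and_congr_right fun _ => mem_ospEnd_iff α τ hα h x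
  · exact mem_gl_iff α τ hα V.rep x

variable [CharZero k] [Finite G]

/-- If S x + x vanishes on V, it vanishes on V' by transposition, being fixed by S. On every other
irreducible x and S x vanish separately, so S x + x = 0. -/
theorem mem_component_iff_mem_lieL (hτ : ∀ g, τ (τ g) = g) (hα : ∀ g, α (τ g) = α g)
    (V : Irr k G) (x : MonoidAlgebra k G) :
    x ∈ component α τ V ↔
      x ∈ blocks (fun W : Irr k G => Iso W.rep V.rep ∨ Iso W.rep (twistDual α τ V.rep)) ∧
      x ∈ lieL α τ hτ hα := by
  rw [mem_component_iff α τ hα, mem_lieL_iff, ← add_eq_zero_iff_eq_neg]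
  refine and_congr_right fun hx => ⟨fun h => eq_zero_of_forall_irr fun W => ?_, fun h => ?_⟩
  · by_cases h₁ : Iso W.rep V.rep
    · exact h₁.asAlgebraHom_eq_zero h
    by_cases h₂ : Iso W.rep (twistDual α τ V.rep)
    · apply h₂.asAlgebraHom_eq_zero
      rwa [twistDual_asAlgebraHom_eq_zero α τ hα, map_add, anti_anti α τ hτ hα, add_comm]
    · rw [map_add, hx W (by tauto), add_zero]
      refine asAlgebraHom_anti_eq_zero α τ hτ hα hx W fun U hU hWU => ?_
      rcases hU with hU | hU
      · exact h₂ (iso_twistDual_comm α τ hτ hα (hWU.trans hU))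
      · exact h₁ ((iso_twistDual_comm α τ hτ hα (hWU.trans hU)).trans
          (iso_twistDual_twistDual α τ hτ hα V.rep).symm)
  · rw [h, map_zero]

omit [CharZero k] [Finite G] in
theorem component_le_lieM (V : Irr k G) : (component α τ V).toSubmodule ≤ lieM α τ :=
  le_iSup_of_le (Quot.mk _ V) <| le_iSup₂_of_le (f := fun W _ => (component α τ W).toSubmodule) V
    rfl le_rfl

theorem lieL_eq_lieM (hτ : ∀ g, τ (τ g) = g) (hα : ∀ g, α (τ g) = α g) :
    (lieL α τ hτ hα).toSubmodule = lieM α τ := by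
  apply le_antisymm
  -- By linearity x may be taken in the block of one V; then S x lies in the block of V', and x - S
  -- x in the component of V.
  · have key (x : MonoidAlgebra k G) : x - anti α τ x ∈ lieM α τ := by
      refine blocks_induction (P := fun x => x - anti α τ x ∈ lieM α τ) (by simp)
        (fun x y hx hy => ?_) (fun V x hx => ?_) x
      · rw [map_add, add_sub_add_comm]; exact add_mem hx hy
      · refine component_le_lieM α τ V ((mem_component_iff_mem_lieL α τ hτ hα V _).2
          ⟨fun W hW => ?_, sub_anti_mem_span α τ x⟩)
        rw [map_sub, hx W (by tauto), zero_sub, neg_eq_zero]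
        exact asAlgebraHom_anti_eq_zero α τ hτ hα hx W fun U hU hWU =>
          hW (Or.inr (iso_twistDual_comm α τ hτ hα (hWU.trans hU)))
    refine Submodule.span_le.2 ?_
    rintro _ ⟨g, rfl⟩
    have := key (MonoidAlgebra.of k G g)
    rwa [MonoidAlgebra.of_apply, anti_single, one_mul] at this
  · refine iSup_le fun c => iSup₂_le fun V _ x hx => ?_
    exact ((mem_component_iff_mem_lieL α τ hτ hα V x).1 hx).2

omit [CharZero k] [Finite G] in
theorem summand_le_blocks (hα : ∀ g, α (τ g) = α g) (c : IrrClass α τ) :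
    summand α τ c ≤ (blocks fun W : Irr k G => (Quot.mk _ W : IrrClass α τ) = c).toSubmodule := by
  refine iSup₂_le fun V hV x hx W hW => ?_
  exact ((mem_component_iff α τ hα V x).1 hx).1 W fun h => hW (hV ▸ Quot.sound h)

/-- An element common to one summand and the sum of the others is killed by the irreducibles outside
the class and by those inside it, hence is zero. -/
theorem iSupIndep_summand (hα : ∀ g, α (τ g) = α g) : iSupIndep (summand α τ) := by
  intro c
  rw [Submodule.disjoint_def]
  intro x hx hx'
  have h : ⨆ (d) (_ : d ≠ c), summand α τ d ≤
      (blocks fun W : Irr k G => (Quot.mk _ W : IrrClass α τ) ≠ c).toSubmodule :=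
    iSup₂_le fun d hd x hx W hW => summand_le_blocks α τ hα d hx W fun h =>
      hW (h.trans_ne hd)
  refine eq_zero_of_forall_irr fun W => ?_
  by_cases hW : (Quot.mk _ W : IrrClass α τ) = c
  · exact h hx' W (not_not.2 hW)
  · exact summand_le_blocks α τ hα c hx W hW

end Component

end TwistedGroupLie

theorem mainTheorem2 {k : Type*} [Field k] [CharZero k] {G : Type*} [Group G] [Finite G]
    (hk : TwistedGroupLie.RepsDefinedOver k G)
    (α : G →* kˣ) (τ : G ≃* G) (hτ : ∀ g, τ (τ g) = g) (hα : ∀ g, α (τ g) = α g) :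
    iSupIndep (TwistedGroupLie.summand α τ) ∧
      (TwistedGroupLie.lieL α τ hτ hα).toSubmodule = TwistedGroupLie.lieM α τ :=
  ⟨TwistedGroupLie.iSupIndep_summand α τ hα, TwistedGroupLie.lieL_eq_lieM α τ hτ hα⟩
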